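/- Let $n\ge 0$, $d=2^n$, let $\rho$ be a density operator on the $n$-qubit space $(\mathbb{C}^2)^{\otimes n}$ and let $|\psi\rangle\in(\mathbb{C}^2)^{\otimes n}$ be a unit vector. Let $\mathcal{C}_n$ be the $n$-qubit Clifford group, that is, the normalizer of the Pauli group $\{i^k\sigma_1\otimes\cdots\otimes\sigma_n : k\in\mathbb{Z},\ \sigma_j\in\{I,X,Y,Z\}\}$ in $U(2^n)$, modulo global phases; it is finite. Let $\hat C$ be uniformly distributed in $\mathcal{C}_n$ and, given $\hat C$, let $\hat b\in\{0,1\}^n$ be the outcome of measuring $\hat C\rho\hat C^\dagger$ in the computational basis, so that $\hat b=b$ has conditional probability $\langle b|\hat C\rho\hat C^\dagger|b\rangle$. Let $F(\rho,\psi)=\left(\operatorname{Tr}\sqrt{\sqrt{\rho}\,|\psi\rangle\langle\psi|\sqrt{\rho}}\right)^2$ be the fidelity. Then $F(\rho,\psi)=\langle\psi|\rho|\psi\rangle$, and, with expectation and variance taken over the joint distribution of $(\hat C,\hat b)$, $$\mathbb{E}\left[|\langle \hat b|\hat C|\psi\rangle|^2\right]=\frac{1+F(\rho,\psi)}{d+1}\qquad\text{and}\qquad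 \operatorname{Var}\left[|\langle\hat b|\hat C|\psi\rangle|^2\right]\le\frac{3}{(d+1)^2}.$$ -/

import Mathlib

open Matrix MeasureTheory ProbabilityTheory
open scoped MatrixOrder ComplexOrder

namespace CliffordShadow

/-- Bit strings `{0,1}^n`; they label the computational basis of the `n`-qubit space. -/
abbrev Bits (n : ℕ) : Type := Fin n → Fin 2

/-- Operators on `n` qubits, as matrices in the computational basis. -/
abbrev Op (n : ℕ) : Type := Matrix (Bits n) (Bits n) ℂ

/-- The unitary group `U(2^n)`. -/
abbrev U (n : ℕ) : Type := Matrix.unitaryGroup (Bits n) ℂ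

/-! ### Pauli group -/

/-- The four one-qubit Pauli matrices `I, X, Y, Z`. -/
noncomputable def pauli : Fin 4 → Matrix (Fin 2) (Fin 2) ℂ :=
  ![!![1, 0; 0, 1], !![0, 1; 1, 0], !![0, -Complex.I; Complex.I, 0], !![1, 0; 0, -1]]

/-- The tensor product `σ_{p 0} ⊗ ⋯ ⊗ σ_{p (n-1)}` of one-qubit Pauli matrices. -/
noncomputable def pauliString {n : ℕ} (p : Fin n → Fin 4) : Op n :=
  fun x y => ∏ j, pauli (p j) (x j) (y j)

theorem pauli_mul (p q : Fin 4) :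
    ∃ (k : ℕ) (r : Fin 4), pauli p * pauli q = Complex.I ^ k • pauli r := by
  have h3 : Complex.I ^ 3 = -Complex.I := Complex.I_pow_three
  fin_cases p <;> fin_cases q
  · exact ⟨0, 0, by ext i j; fin_cases i <;> fin_cases j <;> simp [pauli]⟩
  · exact ⟨0, 1, by ext i j; fin_cases i <;> fin_cases j <;> simp [pauli]⟩
  · exact ⟨0, 2, by ext i j; fin_cases i <;> fin_cases j <;> simp [pauli]⟩
  · exact ⟨0, 3, by ext i j; fin_cases i <;> fin_cases j <;> simp [pauli]⟩
  · exact ⟨0, 1, by ext i j; fin_cases i <;> fin_cases j <;> simp [pauli]⟩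
  · exact ⟨0, 0, by ext i j; fin_cases i <;> fin_cases j <;> simp [pauli]⟩
  · exact ⟨1, 3, by ext i j; fin_cases i <;> fin_cases j <;> simp [pauli]⟩
  · exact ⟨3, 2, by ext i j; fin_cases i <;> fin_cases j <;> simp [pauli, h3]⟩
  · exact ⟨0, 2, by ext i j; fin_cases i <;> fin_cases j <;> simp [pauli]⟩
  · exact ⟨3, 3, by ext i j; fin_cases i <;> fin_cases j <;> simp [pauli, h3]⟩
  · exact ⟨0, 0, by ext i j; fin_cases i <;> fin_cases j <;> simp [pauli]⟩
  · exact ⟨1, 1, by ext i j; fin_cases i <;> fin_cases j <;> simp [pauli]⟩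
  · exact ⟨0, 3, by ext i j; fin_cases i <;> fin_cases j <;> simp [pauli]⟩
  · exact ⟨1, 2, by ext i j; fin_cases i <;> fin_cases j <;> simp [pauli]⟩
  · exact ⟨3, 1, by ext i j; fin_cases i <;> fin_cases j <;> simp [pauli, h3]⟩
  · exact ⟨0, 0, by ext i j; fin_cases i <;> fin_cases j <;> simp [pauli]⟩

theorem pauli_star (p : Fin 4) (i j : Fin 2) : star (pauli p j i) = pauli p i j := by
  fin_cases p <;> fin_cases i <;> fin_cases j <;> simp [pauli]

theorem pauliString_mul {n : ℕ} (p q : Fin n → Fin 4) :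
    ∃ (k : ℕ) (r : Fin n → Fin 4),
      pauliString p * pauliString q = Complex.I ^ k • pauliString r := by
  choose k r h using fun j => pauli_mul (p j) (q j)
  refine ⟨∑ j, k j, r, ?_⟩
  ext x y
  have hj : ∀ j, ∑ z, pauli (p j) (x j) z * pauli (q j) z (y j)
      = Complex.I ^ k j * pauli (r j) (x j) (y j) := fun j => by
    have := congrFun (congrFun (h j) (x j)) (y j)
    simpa [Matrix.mul_apply] using this
  simp only [Matrix.mul_apply, pauliString, Matrix.smul_apply, smul_eq_mul,
    ← Finset.prod_mul_distrib, ← Finset.prod_pow_eq_pow_sum]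
  simp only [← hj]
  rw [Finset.prod_univ_sum]
  simp

theorem pauliString_star {n : ℕ} (p : Fin n → Fin 4) :
    star (pauliString p) = pauliString p := by
  ext x y
  simp only [Matrix.star_apply, pauliString, star_prod, pauli_star]

/-- The `n`-qubit Pauli group: all `i^k σ_{p 0} ⊗ ⋯ ⊗ σ_{p (n-1)}`. -/
noncomputable def pauliGroup (n : ℕ) : Subgroup (U n) where
  carrier := {V | ∃ (k : ℕ) (p : Fin n → Fin 4), (V : Op n) = Complex.I ^ k • pauliString p}
  one_mem' := ⟨0, fun _ => 0, by
    ext x y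
    by_cases h : x = y
    · subst h
      have : ∀ i : Fin 2, pauli 0 i i = 1 := fun i => by fin_cases i <;> simp [pauli]
      simp [pauliString, this]
    · obtain ⟨j, hj⟩ := Function.ne_iff.mp h
      have : ∀ i i' : Fin 2, i ≠ i' → pauli 0 i i' = 0 := fun i i' => by
        fin_cases i <;> fin_cases i' <;> simp [pauli]
      have h0 : ∏ i, pauli 0 (x i) (y i) = 0 :=
        Finset.prod_eq_zero (Finset.mem_univ j) (this _ _ hj)
      simp [pauliString, Matrix.one_apply_ne h, h0]⟩
  mul_mem' := by
    rintro V W ⟨k, p, hV⟩ ⟨l, q, hW⟩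
    obtain ⟨m, r, h⟩ := pauliString_mul p q
    refine ⟨k + l + m, r, ?_⟩
    rw [Submonoid.coe_mul, hV, hW, smul_mul_smul_comm, h, smul_smul, ← pow_add, ← pow_add]
  inv_mem' := by
    rintro V ⟨k, p, hV⟩
    refine ⟨3 * k, p, ?_⟩
    have : ((V⁻¹ : U n) : Op n) = star (V : Op n) := rfl
    rw [this, hV, star_smul, pauliString_star, pow_mul, Complex.I_pow_three]
    simp

instance (n : ℕ) : Finite (pauliGroup n) := by
  let f : Fin 4 × (Fin n → Fin 4) → Op n := fun t => Complex.I ^ (t.1 : ℕ) • pauliString t.2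
  let g : pauliGroup n → Set.range f := fun V => ⟨V.1.1, by
    obtain ⟨k, p, h⟩ := V.2
    exact ⟨(⟨k % 4, Nat.mod_lt _ (by norm_num)⟩, p), by
      rw [h, Complex.I_pow_eq_pow_mod k]⟩⟩
  refine Finite.of_injective g fun V W h => ?_
  have e : (g V).1 = (g W).1 := congrArg Subtype.val h
  exact Subtype.ext (Subtype.ext e)

theorem pauliString_mem_unitary {n : ℕ} (p : Fin n → Fin 4) :
    pauliString p ∈ Matrix.unitaryGroup (Bits n) ℂ := by
  have h1 : pauliString p * pauliString p = 1 := by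
    ext x y
    have hs : ∀ (q : Fin 4) (i i' : Fin 2),
        ∑ z, pauli q i z * pauli q z i' = if i = i' then 1 else 0 := fun q i i' => by
      fin_cases q <;> fin_cases i <;> fin_cases i' <;> simp [pauli]
    have : (pauliString p * pauliString p) x y
        = ∏ j, ∑ z, pauli (p j) (x j) z * pauli (p j) z (y j) := by
      rw [Finset.prod_univ_sum]
      simp [Matrix.mul_apply, pauliString, Finset.prod_mul_distrib]
    rw [this]
    simp only [hs, Matrix.one_apply, Finset.prod_ite_zero, Finset.prod_const_one,
      Finset.mem_univ, true_imp_iff, funext_iff]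
  rw [Matrix.mem_unitaryGroup_iff, pauliString_star, h1]

/-! ### Clifford group -/

/-- The Clifford group as a group of unitaries: the normalizer of the Pauli group in `U(2^n)`. -/
noncomputable def cliffordUnitaries (n : ℕ) : Subgroup (U n) :=
  Subgroup.normalizer (pauliGroup n : Set (U n))

/-- The global phases `z • 1`, `|z| = 1` (they all lie in the normalizer). -/
def globalPhases (n : ℕ) : Subgroup (cliffordUnitaries n) where
  carrier := {V | ∃ z : ℂ, ‖z‖ = 1 ∧ ((V : U n) : Op n) = z • (1 : Op n)}
  one_mem' := ⟨1, by simp, by simp⟩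
  mul_mem' := by
    rintro V W ⟨z, hz, hV⟩ ⟨w, hw, hW⟩
    refine ⟨z * w, by simp [hz, hw], ?_⟩
    rw [Subgroup.coe_mul, Submonoid.coe_mul, hV, hW, smul_mul_smul_comm, mul_one]
  inv_mem' := by
    rintro V ⟨z, hz, hV⟩
    refine ⟨star z, by simpa using hz, ?_⟩
    have : (((V⁻¹ : cliffordUnitaries n) : U n) : Op n) = star ((V : U n) : Op n) := rfl
    rw [this, hV, star_smul, star_one]

/-- The Clifford group `𝒞_n`: Clifford unitaries up to a global phase. It is a finite group. -/
def Clifford (n : ℕ) : Type := cliffordUnitaries n ⧸ globalPhases n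

theorem scalar_of_commute {n : ℕ} (A : Op n)
    (h : ∀ p : Fin n → Fin 4, A * pauliString p = pauliString p * A) :
    ∃ z : ℂ, A = z • (1 : Op n) := by
  have hdiag : ∀ p : Fin n → Fin 4, (∀ j, p j = 0 ∨ p j = 3) → ∀ x y : Bits n, x ≠ y →
      pauliString p x y = 0 := by
    intro p hp x y hxy
    obtain ⟨j, hj⟩ := Function.ne_iff.mp hxy
    refine Finset.prod_eq_zero (Finset.mem_univ j) ?_
    revert hj
    generalize x j = a
    generalize y j = b
    rcases hp j with h | h <;> rw [h] <;> fin_cases a <;> fin_cases b <;> simp [pauli]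
  have hoff : ∀ x y : Bits n, x ≠ y → A x y = 0 := by
    intro x y hxy
    obtain ⟨j, hj⟩ := Function.ne_iff.mp hxy
    let p : Fin n → Fin 4 := fun i => if i = j then 3 else 0
    have hp : ∀ i, p i = 0 ∨ p i = 3 := fun i => by by_cases hi : i = j <;> simp [p, hi]
    have hval : ∀ w : Bits n, pauliString p w w = if w j = 0 then 1 else -1 := by
      intro w
      have : ∀ i, pauli (p i) (w i) (w i)
          = if i = j then (if w j = 0 then 1 else -1) else 1 := by
        intro i
        by_cases hi : i = j
        · subst hi
          simp only [p, if_true]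
          generalize w i = a
          fin_cases a <;> simp [pauli]
        · simp only [p, hi, if_false]
          generalize w i = a
          fin_cases a <;> simp [pauli]
      simp [pauliString, this]
    have e := congrFun (congrFun (h p) x) y
    rw [Matrix.mul_apply, Matrix.mul_apply, Finset.sum_eq_single y, Finset.sum_eq_single x,
      hval, hval] at e
    · revert hj e
      generalize x j = a
      generalize y j = b
      intro hj e
      fin_cases a <;> fin_cases b <;> simp at hj e ⊢ <;>
        first | exact self_eq_neg.mp e | exact self_eq_neg.mp e.symm
    · intro z _ hz
      rw [hdiag p hp x z hz.symm, zero_mul]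
    · simp
    · intro z _ hz
      rw [hdiag p hp z y hz, mul_zero]
    · simp
  have hconst : ∀ x y : Bits n, A x x = A y y := by
    intro x y
    let p : Fin n → Fin 4 := fun i => if x i = y i then 0 else 1
    have hone : pauliString p x y = 1 := by
      refine Finset.prod_eq_one fun i _ => ?_
      simp only [p]
      generalize x i = a
      generalize y i = b
      fin_cases a <;> fin_cases b <;> simp [pauli]
    have e := congrFun (congrFun (h p) x) y
    rw [Matrix.mul_apply, Matrix.mul_apply, Finset.sum_eq_single x, Finset.sum_eq_single y,
      hone] at e
    · simpa using e
    · intro z _ hz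
      rw [hoff z y hz, mul_zero]
    · simp
    · intro z _ hz
      rw [hoff x z hz.symm, zero_mul]
    · simp
  refine ⟨A (fun _ => 0) (fun _ => 0), ?_⟩
  ext x y
  by_cases hxy : x = y
  · subst hxy
    simp [hconst x (fun _ => 0)]
  · simp [hoff x y hxy, Matrix.one_apply_ne hxy]

instance (n : ℕ) : Finite (Clifford n) := by
  let f : Clifford n → pauliGroup n → pauliGroup n := fun q P =>
    ⟨(Quotient.out q : cliffordUnitaries n).1 * P.1 * (Quotient.out q : cliffordUnitaries n).1⁻¹,
      (Subgroup.mem_normalizer_iff.mp (Quotient.out q : cliffordUnitaries n).2 P.1).mp P.2⟩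
  refine Finite.of_injective f fun q q' h => ?_
  rw [← Quotient.out_eq q, ← Quotient.out_eq q']
  set V : cliffordUnitaries n := Quotient.out q
  set W : cliffordUnitaries n := Quotient.out q'
  refine QuotientGroup.eq.mpr ?_
  have hc : ∀ p : Fin n → Fin 4, (((V⁻¹ * W : cliffordUnitaries n) : U n) : Op n) * pauliString p
      = pauliString p * (((V⁻¹ * W : cliffordUnitaries n) : U n) : Op n) := by
    intro p
    have e := congrArg Subtype.val
      (congrFun h ⟨⟨pauliString p, pauliString_mem_unitary p⟩, 0, p, by simp⟩)
    have e2 : V.1 * ⟨pauliString p, pauliString_mem_unitary p⟩ * V.1⁻¹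
      = W.1 * ⟨pauliString p, pauliString_mem_unitary p⟩ * W.1⁻¹ := e
    have e3 : (V.1⁻¹ * W.1) * (⟨pauliString p, pauliString_mem_unitary p⟩ : U n)
        = ⟨pauliString p, pauliString_mem_unitary p⟩ * (V.1⁻¹ * W.1) := by
      calc _ = V.1⁻¹ * (W.1 * ⟨pauliString p, pauliString_mem_unitary p⟩ * W.1⁻¹) * W.1 := by group
        _ = _ := by rw [← e2]; group
    exact congrArg Subtype.val e3
  obtain ⟨z, hz⟩ := scalar_of_commute _ hc
  refine ⟨z, ?_, hz⟩
  have hu := Matrix.mem_unitaryGroup_iff.mp ((V⁻¹ * W : cliffordUnitaries n) : U n).2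
  rw [hz] at hu
  have e := congrFun (congrFun hu (fun _ => 0)) (fun _ => 0)
  simp only [star_smul, star_one, smul_mul_smul_comm, mul_one, Matrix.smul_apply, Matrix.one_apply_eq,
    smul_eq_mul, Complex.star_def, Complex.mul_conj, Complex.normSq_eq_norm_sq] at e
  norm_cast at e
  exact (pow_eq_one_iff_of_nonneg (norm_nonneg z) two_ne_zero).mp e

noncomputable instance (n : ℕ) : Fintype (Clifford n) := Fintype.ofFinite _

instance (n : ℕ) : Nonempty (Clifford n) := ⟨Quotient.mk _ 1⟩

instance (n : ℕ) : MeasurableSpace (Clifford n) := ⊤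

instance (n : ℕ) : DiscreteMeasurableSpace (Clifford n) := ⟨fun _ => trivial⟩

/-! ### States, measurement, fidelity -/

/-- Density operators on `n` qubits. -/
def Density (n : ℕ) : Type := {ρ : Op n // ρ.PosSemidef ∧ ρ.trace = 1}

/-- The pure state `|ψ⟩⟨ψ|`. -/
def pureState {n : ℕ} (ψ : EuclideanSpace ℂ (Bits n)) (hψ : ‖ψ‖ = 1) : Density n :=
  ⟨vecMulVec ψ.ofLp (star ψ.ofLp), Matrix.posSemidef_vecMulVec_self_star _, by
    rw [Matrix.trace_vecMulVec]
    have h := EuclideanSpace.inner_eq_star_dotProduct ψ ψ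
    rw [inner_self_eq_norm_sq_to_K, hψ] at h
    simpa using h.symm⟩

/-- The expectation value `⟨ψ|ρ|ψ⟩`. -/
def expVal {n : ℕ} (ρ : Density n) (ψ : EuclideanSpace ℂ (Bits n)) : ℂ :=
  star ψ.ofLp ⬝ᵥ (ρ.1 *ᵥ ψ.ofLp)

/-- The fidelity `F(ρ, σ) = (Tr √(√ρ σ √ρ))²`; the trace is that of a positive operator. -/
noncomputable def fidelity {n : ℕ} (ρ σ : Density n) : ℝ :=
  (CFC.sqrt (CFC.sqrt ρ.1 * σ.1 * CFC.sqrt ρ.1)).trace.re ^ 2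

/-- The rotated state `V ρ V†`. -/
def rotate {n : ℕ} (V : U n) (ρ : Density n) : Density n :=
  ⟨V.1 * ρ.1 * V.1ᴴ, ρ.2.1.mul_mul_conjTranspose_same _, by
    have h : V.1ᴴ * V.1 = 1 := Matrix.mem_unitaryGroup_iff'.mp V.2
    rw [Matrix.trace_mul_comm, ← Matrix.mul_assoc, h, one_mul, ρ.2.2]⟩

/-- The outcome distribution of a computational-basis measurement of `σ` (Born rule):
`b` has probability `⟨b|σ|b⟩`. -/
noncomputable def outcomeLaw {n : ℕ} (σ : Density n) : PMF (Bits n) :=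
  PMF.ofFintype (fun b => ENNReal.ofReal (σ.1 b b).re) (by
    rw [← ENNReal.ofReal_sum_of_nonneg]
    · have h := congrArg Complex.re σ.2.2
      simp only [Matrix.trace, Matrix.diag_apply, Complex.re_sum, Complex.one_re] at h
      simp [h]
    · exact fun b _ => (Complex.le_def.mp (σ.2.1.diag_nonneg (i := b))).1)

/-- `|⟨b|V|ψ⟩|²`. -/
noncomputable def overlapOp {n : ℕ} (V : U n) (ψ : EuclideanSpace ℂ (Bits n)) (b : Bits n) : ℝ :=
  ‖(V.1 *ᵥ ψ.ofLp) b‖ ^ 2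

theorem exists_phase {n : ℕ} {V W : cliffordUnitaries n}
    (h : (QuotientGroup.leftRel (globalPhases n)) V W) :
    ∃ z : ℂ, ‖z‖ = 1 ∧ W.1.1 = z • V.1.1 := by
  obtain ⟨z, hz, e⟩ := QuotientGroup.leftRel_apply.mp h
  refine ⟨z, hz, ?_⟩
  have : W = V * (V⁻¹ * W) := by group
  rw [this, Subgroup.coe_mul, Submonoid.coe_mul, e, mul_smul_comm, mul_one]

/-- The rotated state `C ρ C†` for a Clifford `C`; it does not depend on the phase of `C`. -/
noncomputable def Clifford.rotate {n : ℕ} (C : Clifford n) (ρ : Density n) : Density n :=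
  Quotient.lift (fun V : cliffordUnitaries n => CliffordShadow.rotate V.1 ρ) (fun V W h => by
    obtain ⟨z, hz, e⟩ := exists_phase h
    refine Subtype.ext ?_
    have hzz : z * star z = 1 := by
      rw [Complex.star_def, Complex.mul_conj, Complex.normSq_eq_norm_sq, hz]; simp
    simp only [CliffordShadow.rotate, e, Matrix.conjTranspose_smul, Matrix.smul_mul,
      Matrix.mul_smul, smul_smul, hzz, mul_comm (star z) z, one_smul]) C

/-- `|⟨b|C|ψ⟩|²` for a Clifford `C`; it does not depend on the phase of `C`. -/
noncomputable def Clifford.overlap {n : ℕ} (C : Clifford n) (ψ : EuclideanSpace ℂ (Bits n))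
    (b : Bits n) : ℝ :=
  Quotient.lift (fun V : cliffordUnitaries n => overlapOp V.1 ψ b) (fun V W h => by
    obtain ⟨z, hz, e⟩ := exists_phase h
    simp only [overlapOp, e, Matrix.smul_mulVec, Pi.smul_apply, norm_smul, hz, one_mul]) C

/-- The joint law of `(Ĉ, b̂)`: `Ĉ` is uniform in the Clifford group, and, given `Ĉ`, `b̂` is the
outcome of a computational-basis measurement of `Ĉ ρ Ĉ†`. -/
noncomputable def shadowLaw {n : ℕ} (ρ : Density n) : PMF (Clifford n × Bits n) :=
  (PMF.uniformOfFintype (Clifford n)).bind fun C =>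
    (outcomeLaw (C.rotate ρ)).map fun b => (C, b)

end CliffordShadow

namespace CliffordShadow

/-! ### Pauli operators indexed by the binary phase space -/

/-! The expectation and the second moment are Clifford averages of `∑ b` of two or three diagonal
entries of conjugated operators, and the Pauli basis makes both computable. A Clifford unitary sends
each Pauli string to a phase times a Pauli string, which is either diagonal or has zero diagonal.
Taking diagonals therefore just selects Pauli coefficients (`diagonal_diag_conj`), and the moments
depend only on `pairSum u v`, which counts the Cliffords that make both `W_u` and `W_v` diagonal.

These counts follow from symmetry and double counting. The unitaries `(1 + i W_w) / √2` are Clifford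
and act on labels as symplectic transvections, so `pairSum` is transvection invariant. Hence it is
constant on nonzero `u` paired with `0`, and, for fixed `u ≠ 0`, on the `v` orthogonal to `u`
outside its span. It vanishes on anticommuting pairs, since diagonal matrices commute. As each
Clifford makes exactly `2 ^ n` strings diagonal (`sum_diagIndOp`), the remaining values are forced
(`pairSum_eq`).

Resumming with Pauli completeness gives, with `d = 2 ^ n`, mean `(1 + F) / (d + 1)` and second
moment `(2 + 4F) / ((d + 1)(d + 2))`. The variance bound is then elementary. -/

/-- The binary phase space `(𝔽₂²)^n`, which labels the Pauli strings. -/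
abbrev Phase (n : ℕ) : Type := Fin n → ZMod 2 × ZMod 2

/-- The one-qubit Pauli label of a point of `𝔽₂²`. -/
def pauliIndex (a : ZMod 2 × ZMod 2) : Fin 4 :=
  if a.1 = 0 then (if a.2 = 0 then 0 else 3) else (if a.2 = 0 then 1 else 2)

theorem pauliIndex_surjective : Function.Surjective pauliIndex := by decide

/-- The Pauli string labelled by a point of phase space. -/
noncomputable def weyl {n : ℕ} (v : Phase n) : Op n := pauliString fun j => pauliIndex (v j)

/-- The one-qubit symplectic form. -/
def sympOne (a b : ZMod 2 × ZMod 2) : ZMod 2 := a.1 * b.2 + a.2 * b.1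

/-- The symplectic form on phase space. -/
def symp {n : ℕ} (u v : Phase n) : ZMod 2 := ∑ j, sympOne (u j) (v j)

/-- The nontrivial character of `𝔽₂`. -/
def parity (a : ZMod 2) : ℂ := if a = 0 then 1 else -1

theorem parity_add (a b : ZMod 2) : parity (a + b) = parity a * parity b := by
  have h : ∀ a : ZMod 2, a = 0 ∨ a = 1 := by decide
  have e2 : (1 + 1 : ZMod 2) = 0 := by decide
  rcases h a with rfl | rfl <;> rcases h b with rfl | rfl <;> simp [parity, e2]

theorem parity_sum {ι : Type*} (s : Finset ι) (f : ι → ZMod 2) :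
    parity (∑ j ∈ s, f j) = ∏ j ∈ s, parity (f j) := by
  classical
  induction s using Finset.induction_on with
  | empty => simp [parity]
  | insert a s ha ih => rw [Finset.sum_insert ha, Finset.prod_insert ha, parity_add, ih]

theorem forall_zmod_two_prod {P : ZMod 2 × ZMod 2 → Prop} (h00 : P (0, 0)) (h01 : P (0, 1))
    (h10 : P (1, 0)) (h11 : P (1, 1)) (a : ZMod 2 × ZMod 2) : P a := by
  obtain ⟨x, y⟩ := a
  fin_cases x <;> fin_cases y <;> assumption

/-- With `X = (1,0)`, `Z = (0,1)`, `Y = (1,1)`, Pauli multiplication modulo phases is addition in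
`𝔽₂²`. Only the phases `1`, `i`, `-i` arise, hence the exponents tried. -/
theorem pauli_mul_index (a b : ZMod 2 × ZMod 2) :
    ∃ k : ℕ, pauli (pauliIndex a) * pauli (pauliIndex b)
      = Complex.I ^ k • pauli (pauliIndex (a + b)) := by
  have h3 : Complex.I ^ 3 = -Complex.I := Complex.I_pow_three
  have e0 : pauliIndex 0 = 0 := by decide
  have e00 : pauliIndex (0, 0) = 0 := by decide
  have e01 : pauliIndex (0, 1) = 3 := by decide
  have e10 : pauliIndex (1, 0) = 1 := by decide
  have e11 : pauliIndex (1, 1) = 2 := by decide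
  have e2 : (1 + 1 : ZMod 2) = 0 := by decide
  revert b
  revert a
  refine forall_zmod_two_prod ?_ ?_ ?_ ?_ <;> refine forall_zmod_two_prod ?_ ?_ ?_ ?_ <;>
    simp only [Prod.mk_add_mk, add_zero, zero_add, e2, e00, e01, e10, e11] <;>
    first
    | (refine ⟨0, ?_⟩; ext i j; fin_cases i <;> fin_cases j <;> simp [pauli] <;> done)
    | (refine ⟨1, ?_⟩; ext i j; fin_cases i <;> fin_cases j <;> simp [pauli] <;> done)
    | (refine ⟨3, ?_⟩; ext i j; fin_cases i <;> fin_cases j <;> simp [pauli, h3])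

theorem pauli_comm_index (a b : ZMod 2 × ZMod 2) :
    pauli (pauliIndex a) * pauli (pauliIndex b)
      = parity (sympOne a b) • (pauli (pauliIndex b) * pauli (pauliIndex a)) := by
  have e00 : pauliIndex (0, 0) = 0 := by decide
  have e01 : pauliIndex (0, 1) = 3 := by decide
  have e10 : pauliIndex (1, 0) = 1 := by decide
  have e11 : pauliIndex (1, 1) = 2 := by decide
  have e2 : (1 + 1 : ZMod 2) = 0 := by decide
  revert b
  revert a
  refine forall_zmod_two_prod ?_ ?_ ?_ ?_ <;> refine forall_zmod_two_prod ?_ ?_ ?_ ?_ <;>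
    simp only [sympOne, e00, e01, e10, e11] <;>
    ext i j <;> fin_cases i <;> fin_cases j <;> simp [pauli, parity, e2]

/-- Entrywise form of `∑ P ⊗ P = 2 • SWAP` on two qubits, the source of Pauli completeness. -/
theorem sum_pauli_index (x y z w : Fin 2) :
    ∑ a, pauli (pauliIndex a) x y * pauli (pauliIndex a) z w
      = if x = w ∧ y = z then 2 else 0 := by
  have e00 : pauliIndex (0, 0) = 0 := by decide
  have e01 : pauliIndex (0, 1) = 3 := by decide
  have e10 : pauliIndex (1, 0) = 1 := by decide
  have e11 : pauliIndex (1, 1) = 2 := by decide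
  have hu : ∀ f : ZMod 2 → ℂ, ∑ a, f a = f 0 + f 1 := fun f => Fin.sum_univ_two f
  rw [Fintype.sum_prod_type]
  have p0 : pauli 0 = !![1, 0; 0, 1] := rfl
  have p1 : pauli 1 = !![0, 1; 1, 0] := rfl
  have p2 : pauli 2 = !![0, -Complex.I; Complex.I, 0] := rfl
  have p3 : pauli 3 = !![1, 0; 0, -1] := rfl
  simp only [hu, e00, e01, e10, e11, p0, p1, p2, p3]
  fin_cases x <;> fin_cases y <;> fin_cases z <;> fin_cases w <;>
    norm_num [Complex.I_mul_I]

theorem pauliString_mul_apply {n : ℕ} (p q : Fin n → Fin 4) (x y : Bits n) :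
    (pauliString p * pauliString q) x y
      = ∏ j, (pauli (p j) * pauli (q j)) (x j) (y j) := by
  simp only [Matrix.mul_apply, pauliString, ← Finset.prod_mul_distrib]
  rw [Finset.prod_univ_sum]
  simp

theorem weyl_mul {n : ℕ} (u v : Phase n) :
    ∃ k : ℕ, weyl u * weyl v = Complex.I ^ k • weyl (u + v) := by
  choose k h using fun j => pauli_mul_index (u j) (v j)
  refine ⟨∑ j, k j, ?_⟩
  ext x y
  rw [weyl, weyl, pauliString_mul_apply]
  simp only [h, Matrix.smul_apply, smul_eq_mul, Finset.prod_mul_distrib,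
    Finset.prod_pow_eq_pow_sum]
  rfl

theorem weyl_comm {n : ℕ} (u v : Phase n) :
    weyl u * weyl v = parity (symp u v) • (weyl v * weyl u) := by
  ext x y
  rw [Matrix.smul_apply, weyl, weyl, pauliString_mul_apply, pauliString_mul_apply, symp,
    parity_sum, smul_eq_mul, ← Finset.prod_mul_distrib]
  refine Finset.prod_congr rfl fun j _ => ?_
  rw [pauli_comm_index]
  rfl

theorem weyl_conjTranspose {n : ℕ} (v : Phase n) : (weyl v)ᴴ = weyl v := pauliString_star _

theorem weyl_mul_self {n : ℕ} (v : Phase n) : weyl v * weyl v = 1 := by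
  have h := Matrix.mem_unitaryGroup_iff.mp (pauliString_mem_unitary fun j => pauliIndex (v j))
  rwa [pauliString_star] at h

theorem weyl_zero (n : ℕ) : weyl (0 : Phase n) = 1 := by
  have e0 : pauliIndex 0 = 0 := by decide
  have e1 : pauli 0 = 1 := by ext i j; fin_cases i <;> fin_cases j <;> simp [pauli]
  ext x y
  simp only [weyl, pauliString, Pi.zero_apply, e0, e1, Matrix.one_apply, Finset.prod_ite_zero,
    Finset.prod_const_one, Finset.mem_univ, true_imp_iff, funext_iff]

theorem sum_weyl_apply {n : ℕ} (x y z w : Bits n) :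
    ∑ v : Phase n, weyl v x y * weyl v z w = if x = w ∧ y = z then 2 ^ n else 0 := by
  have h := Finset.prod_univ_sum (fun _ : Fin n => (Finset.univ : Finset (ZMod 2 × ZMod 2)))
    (fun j a => pauli (pauliIndex a) (x j) (y j) * pauli (pauliIndex a) (z j) (w j))
  simp only [Fintype.piFinset_univ, Finset.prod_mul_distrib, sum_pauli_index] at h
  refine h.symm.trans ?_
  rw [Finset.prod_ite_zero]
  simp [funext_iff, forall_and]

/-- Completeness of the Pauli operators. -/
theorem sum_trace_weyl_smul {n : ℕ} (A : Op n) :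
    ∑ v, (weyl v * A).trace • weyl v = (2 : ℂ) ^ n • A := by
  ext x y
  simp only [Matrix.sum_apply, Matrix.smul_apply, smul_eq_mul, Matrix.trace, Matrix.diag_apply,
    Matrix.mul_apply, Finset.sum_mul]
  rw [Finset.sum_comm]
  simp_rw [Finset.sum_comm (s := (Finset.univ : Finset (Phase n)))]
  have : ∀ i j : Bits n, ∑ v, weyl v i j * A j i * weyl v x y
      = A j i * if i = y ∧ j = x then 2 ^ n else 0 := fun i j => by
    rw [← sum_weyl_apply, Finset.mul_sum]
    exact Finset.sum_congr rfl fun v _ => by ring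
  simp only [this, ite_and, mul_ite, mul_zero]
  simp [mul_comm]

theorem sum_trace_weyl_mul_trace_weyl {n : ℕ} (A B : Op n) :
    ∑ v, (weyl v * A).trace * (weyl v * B).trace = (2 : ℂ) ^ n * (A * B).trace := by
  have h := congrArg (fun M => (M * B).trace) (sum_trace_weyl_smul A)
  simpa [Finset.sum_mul, Matrix.trace_sum] using h

theorem parity_eq_one_iff (a : ZMod 2) : parity a = 1 ↔ a = 0 := by
  by_cases h : a = 0
  · simp [parity, h]
  · simp only [parity, h, if_false, iff_false]
    norm_num

theorem zmod_two_ne_zero {a : ZMod 2} (h : a ≠ 0) : a = 1 := by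
  revert a; decide

/-- Pauli strings commute or anticommute, and in the second case the anticommutator vanishes. This
turns a sum over commuting pairs into an unrestricted one. -/
theorem ite_symp_smul_weyl_mul {n : ℕ} (u v : Phase n) :
    (if symp u v = 0 then (1 : ℂ) else 0) • (weyl u * weyl v)
      = (1 / 2 : ℂ) • (weyl u * weyl v + weyl v * weyl u) := by
  rw [weyl_comm u v]
  by_cases h : symp u v = 0
  · rw [if_pos h, (parity_eq_one_iff _).mpr h, one_smul, one_smul, ← two_smul ℂ, smul_smul]
    norm_num
  · simp [h, parity]

/-! ### The symplectic form -/

theorem sympOne_add_right (a b c : ZMod 2 × ZMod 2) :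
    sympOne a (b + c) = sympOne a b + sympOne a c := by
  simp only [sympOne, Prod.fst_add, Prod.snd_add]; ring

theorem sympOne_comm (a b : ZMod 2 × ZMod 2) : sympOne a b = sympOne b a := by
  simp only [sympOne]; ring

theorem symp_add_right {n : ℕ} (u v w : Phase n) : symp u (v + w) = symp u v + symp u w := by
  simp only [symp, Pi.add_apply, sympOne_add_right, Finset.sum_add_distrib]

theorem symp_comm {n : ℕ} (u v : Phase n) : symp u v = symp v u :=
  Finset.sum_congr rfl fun _ _ => sympOne_comm _ _

theorem symp_add_left {n : ℕ} (u v w : Phase n) : symp (u + v) w = symp u w + symp v w := by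
  rw [symp_comm, symp_add_right, symp_comm w, symp_comm w]

theorem symp_self {n : ℕ} (u : Phase n) : symp u u = 0 :=
  Finset.sum_eq_zero fun j _ => by
    generalize u j = a
    revert a
    decide

theorem symp_zero_right {n : ℕ} (u : Phase n) : symp u 0 = 0 := by
  simp [symp, sympOne]

theorem symp_zero_left {n : ℕ} (u : Phase n) : symp 0 u = 0 := by
  simp [symp, sympOne]

theorem Phase.add_self {n : ℕ} (u : Phase n) : u + u = 0 := by
  funext j
  change u j + u j = 0
  generalize u j = a
  revert a
  decide

theorem Phase.eq_of_add_eq_zero {n : ℕ} {u v : Phase n} (h : u + v = 0) : u = v := by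
  have := congrArg (· + v) h
  simpa [add_assoc, Phase.add_self] using this

theorem exists_symp_eq_one {n : ℕ} {u : Phase n} (hu : u ≠ 0) : ∃ w, symp u w = 1 := by
  obtain ⟨j, hj⟩ := Function.ne_iff.mp hu
  have h1 : ∀ a : ZMod 2 × ZMod 2, a ≠ 0 → ∃ b, sympOne a b = 1 := by decide
  obtain ⟨b, hb⟩ := h1 (u j) hj
  refine ⟨Pi.single j b, ?_⟩
  rw [symp, Finset.sum_eq_single j]
  · simpa using hb
  · intro i _ hi
    simp [Pi.single_eq_of_ne hi, sympOne]
  · simp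

theorem exists_symp_zero_one {n : ℕ} {u v : Phase n} (hv : v ≠ 0) (huv : v ≠ u) :
    ∃ w, symp u w = 0 ∧ symp v w = 1 := by
  obtain ⟨w₁, h₁⟩ := exists_symp_eq_one hv
  by_cases hu₁ : symp u w₁ = 0
  · exact ⟨w₁, hu₁, h₁⟩
  obtain ⟨w₂, h₂⟩ := exists_symp_eq_one (u := u + v)
    fun h => huv (Phase.eq_of_add_eq_zero h).symm
  rw [symp_add_left] at h₂
  by_cases hu₂ : symp u w₂ = 0
  · exact ⟨w₂, hu₂, by simpa [hu₂] using h₂⟩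
  -- Here `u` pairs to `1` with both vectors, while `v` pairs to `1` with `w₁` and to `0` with `w₂`,
  -- so the sum works.
  refine ⟨w₁ + w₂, ?_, ?_⟩ <;> rw [symp_add_right]
  · rw [zmod_two_ne_zero hu₁, zmod_two_ne_zero hu₂]; decide
  · rw [zmod_two_ne_zero hu₂] at h₂
    rw [h₁, left_eq_add.mp h₂.symm]; decide

/-- Inside the complement of `u`, the kernels of `v` and `v'` are proper subgroups, and a group is
not the union of two such. The vector found links `v` to `v'` by two transvections that fix `u` when
both are orthogonal to `u`. -/
theorem exists_symp_zero_one_one {n : ℕ} {u v v' : Phase n} (hv : v ≠ 0) (huv : v ≠ u)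
    (hv' : v' ≠ 0) (huv' : v' ≠ u) : ∃ w, symp u w = 0 ∧ symp v w = 1 ∧ symp v' w = 1 := by
  obtain ⟨w₁, h₁, h₁'⟩ := exists_symp_zero_one hv huv
  obtain ⟨w₂, h₂, h₂'⟩ := exists_symp_zero_one hv' huv'
  by_cases k₁ : symp v' w₁ = 0
  · by_cases k₂ : symp v w₂ = 0
    · exact ⟨w₁ + w₂, by rw [symp_add_right, h₁, h₂, add_zero],
        by rw [symp_add_right, h₁', k₂, add_zero], by rw [symp_add_right, k₁, h₂', zero_add]⟩
    · exact ⟨w₂, h₂, zmod_two_ne_zero k₂, h₂'⟩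
  · exact ⟨w₁, h₁, h₁', zmod_two_ne_zero k₁⟩

/-- The symplectic transvection along `w`. -/
def transvection {n : ℕ} (w v : Phase n) : Phase n := if symp w v = 0 then v else w + v

theorem transvection_zero {n : ℕ} (w : Phase n) : transvection w 0 = 0 := by
  simp [transvection, symp_zero_right]

theorem transvection_add_self {n : ℕ} {u v : Phase n} (h : symp u v = 1) :
    transvection (u + v) u = v := by
  rw [transvection, symp_add_left, symp_self, symp_comm, h, zero_add, if_neg one_ne_zero,
    add_right_comm, Phase.add_self, zero_add]

theorem transvection_of_symp_eq_zero {n : ℕ} {w u : Phase n} (h : symp w u = 0) :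
    transvection w u = u := if_pos h

theorem card_phase (n : ℕ) : (Fintype.card (Phase n) : ℝ) = (2 ^ n) ^ 2 := by
  rw [← pow_mul, mul_comm n 2, pow_mul]
  simp
  norm_num

/-- Translation by a vector pairing to `1` with `u` exchanges the kernel of `symp u` with its
complement. -/
theorem card_symp_eq_zero {n : ℕ} {u : Phase n} (hu : u ≠ 0) :
    (2 : ℝ) * (Finset.univ.filter fun v => symp u v = 0).card = (2 ^ n) ^ 2 := by
  obtain ⟨w, hw⟩ := exists_symp_eq_one hu
  have h1 : (Finset.univ.filter fun v => symp u v = 0).card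
      = (Finset.univ.filter fun v => ¬ symp u v = 0).card := by
    refine Finset.card_bij (fun v _ => w + v) ?_ ?_ ?_
    · intro v hv
      simp only [Finset.mem_filter, Finset.mem_univ, true_and] at hv ⊢
      rw [symp_add_right, hw, hv]
      decide
    · intro v _ v' _ h
      exact add_left_cancel h
    · intro v hv
      simp only [Finset.mem_filter, Finset.mem_univ, true_and] at hv
      refine ⟨w + v, ?_, by rw [← add_assoc, Phase.add_self, zero_add]⟩
      simp only [Finset.mem_filter, Finset.mem_univ, true_and]
      rw [symp_add_right, hw, zmod_two_ne_zero hv]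
      decide
  have h2 := Finset.card_filter_add_card_filter_not (s := (Finset.univ : Finset (Phase n)))
    (fun v => symp u v = 0)
  rw [← h1, Finset.card_univ] at h2
  rw [← card_phase, ← h2]
  push_cast
  ring

/-! ### Clifford transvections -/

/-- The Clifford unitary `(1 + i W_w) / √2`, which implements the transvection along `w`. -/
noncomputable def cliffordTransvection {n : ℕ} (w : Phase n) : Op n :=
  (((√2)⁻¹ : ℝ) : ℂ) • (1 + Complex.I • weyl w)

theorem cliffordTransvection_conj {n : ℕ} (w : Phase n) (A : Op n) :
    cliffordTransvection w * A * (cliffordTransvection w)ᴴ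
      = (1 / 2 : ℂ) • (A + Complex.I • (weyl w * A - A * weyl w) + weyl w * A * weyl w) := by
  have hs : (((√2)⁻¹ : ℝ) : ℂ) * (((√2)⁻¹ : ℝ) : ℂ) = 1 / 2 := by
    rw [← Complex.ofReal_mul, ← mul_inv, Real.mul_self_sqrt zero_le_two]
    norm_num
  have hc : (cliffordTransvection w)ᴴ
      = (((√2)⁻¹ : ℝ) : ℂ) • (1 - Complex.I • weyl w) := by
    rw [cliffordTransvection, Matrix.conjTranspose_smul, Matrix.conjTranspose_add,
      Matrix.conjTranspose_smul, weyl_conjTranspose, Matrix.conjTranspose_one, Complex.star_def,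
      Complex.conj_ofReal, Complex.conj_I, neg_smul, sub_eq_add_neg]
  rw [hc, cliffordTransvection, smul_mul_assoc, smul_mul_smul_comm, hs]
  congr 1
  simp only [add_mul, mul_sub, one_mul, mul_one, smul_mul_assoc, mul_smul_comm, smul_sub,
    smul_add]
  rw [smul_smul, Complex.I_mul_I, neg_one_smul]
  abel

theorem cliffordTransvection_mul_conjTranspose {n : ℕ} (w : Phase n) :
    cliffordTransvection w * (cliffordTransvection w)ᴴ = 1 := by
  have h := cliffordTransvection_conj w 1
  rw [mul_one, mul_one, one_mul, sub_self, weyl_mul_self, smul_zero, add_zero, ← two_smul ℂ,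
    smul_smul] at h
  simpa using h

theorem cliffordTransvection_conj_weyl {n : ℕ} (w v : Phase n) :
    ∃ k : ℕ, cliffordTransvection w * weyl v * (cliffordTransvection w)ᴴ
      = Complex.I ^ k • weyl (transvection w v) := by
  rw [cliffordTransvection_conj, weyl_comm w v]
  by_cases h : symp w v = 0
  · refine ⟨0, ?_⟩
    rw [transvection, if_pos h, (parity_eq_one_iff _).mpr h, one_smul, sub_self, mul_assoc,
      weyl_mul_self, mul_one, smul_zero, add_zero, ← two_smul ℂ, smul_smul]
    norm_num
  · obtain ⟨k, hk⟩ := weyl_mul w v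
    -- In the anticommuting case `W_w W_v W_w = -W_v` cancels the first term, and half the
    -- commutator is `W_w W_v`; its prefactor `i` adds one to the exponent.
    refine ⟨k + 1, ?_⟩
    have hp : parity (symp w v) = -1 := if_neg h
    have hc := weyl_comm w v
    rw [hk, hp, neg_one_smul] at hc
    rw [transvection, if_neg h, hp, neg_one_smul, neg_mul, mul_assoc, weyl_mul_self, mul_one,
      add_right_comm, add_neg_cancel, zero_add, ← neg_add', ← two_smul ℂ, ← smul_neg, ← hc,
      smul_smul, smul_smul, smul_smul, pow_succ]
    congr 1
    ring

theorem weyl_mem_unitaryGroup {n : ℕ} (v : Phase n) : weyl v ∈ Matrix.unitaryGroup (Bits n) ℂ :=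
  pauliString_mem_unitary _

theorem exists_weyl_eq {n : ℕ} (p : Fin n → Fin 4) : ∃ v : Phase n, weyl v = pauliString p := by
  choose f hf using pauliIndex_surjective
  exact ⟨fun j => f (p j), by simp only [weyl, hf]⟩

theorem cliffordTransvection_mem_unitaryGroup {n : ℕ} (w : Phase n) :
    cliffordTransvection w ∈ Matrix.unitaryGroup (Bits n) ℂ :=
  Matrix.mem_unitaryGroup_iff.mpr (cliffordTransvection_mul_conjTranspose w)

theorem cliffordTransvection_mem_cliffordUnitaries {n : ℕ} (w : Phase n) :
    (⟨cliffordTransvection w, cliffordTransvection_mem_unitaryGroup w⟩ : U n)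
      ∈ cliffordUnitaries n := by
  -- For a finite subgroup, conjugation into itself is already onto, so one inclusion suffices.
  have : Finite ↑(pauliGroup n : Set (U n)) := inferInstanceAs (Finite (pauliGroup n))
  refine Subgroup.mem_normalizer_fintype (S := (pauliGroup n : Set (U n))) ?_
  rintro V ⟨k, p, hV⟩
  obtain ⟨v, hv⟩ := exists_weyl_eq p
  obtain ⟨l, hl⟩ := cliffordTransvection_conj_weyl w v
  refine ⟨k + l, fun j => pauliIndex (transvection w v j), ?_⟩
  change cliffordTransvection w * (V : Op n) * (cliffordTransvection w)ᴴ = _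
  rw [hV, ← hv, mul_smul_comm, smul_mul_assoc, hl, smul_smul, pow_add]
  rfl

theorem conj_weyl_eq {n : ℕ} (V : cliffordUnitaries n) (v : Phase n) :
    ∃ (k : ℕ) (u : Phase n), V.1.1 * weyl v * V.1.1ᴴ = Complex.I ^ k • weyl u := by
  obtain ⟨k, p, h⟩ := (Subgroup.mem_normalizer_iff.mp V.2 ⟨weyl v, weyl_mem_unitaryGroup v⟩).mp
    ⟨0, fun j => pauliIndex (v j), by simp [weyl]⟩
  obtain ⟨u, hu⟩ := exists_weyl_eq p
  exact ⟨k, u, by rw [hu]; exact h⟩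

/-! ### Diagonal parts of conjugated Pauli strings -/

/-- A single `X` or `Y` factor kills every diagonal entry; without one, all factors are `I` or `Z`.
-/
theorem weyl_isDiag_or_diag_eq_zero {n : ℕ} (v : Phase n) :
    (weyl v).IsDiag ∨ (weyl v).diag = 0 := by
  have h1 : ∀ q : Fin 4, (∀ x y, x ≠ y → pauli q x y = 0) ∨ ∀ x, pauli q x x = 0 := by
    intro q
    fin_cases q
    · left
      intro x y; fin_cases x <;> fin_cases y <;> simp [pauli]
    · right
      intro x; fin_cases x <;> simp [pauli]
    · right
      intro x; fin_cases x <;> simp [pauli]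
    · left
      intro x y; fin_cases x <;> fin_cases y <;> simp [pauli]
  by_cases h : ∃ j, ∀ x, pauli (pauliIndex (v j)) x x = 0
  · obtain ⟨j, hj⟩ := h
    right
    funext x
    exact Finset.prod_eq_zero (Finset.mem_univ j) (hj (x j))
  · left
    intro x y hxy
    obtain ⟨j, hj⟩ := Function.ne_iff.mp hxy
    exact Finset.prod_eq_zero (Finset.mem_univ j)
      ((h1 _).resolve_right (fun h' => h ⟨j, h'⟩) _ _ hj)

open Classical in
/-- `1` if `V W_v V†` is diagonal, and `0` otherwise. -/
noncomputable def diagIndOp {n : ℕ} (V : Op n) (v : Phase n) : ℝ :=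
  if (V * weyl v * Vᴴ).IsDiag then 1 else 0

open Classical in
theorem diagIndOp_congr {n : ℕ} {V W : Op n} {u v : Phase n}
    (h : (V * weyl u * Vᴴ).IsDiag ↔ (W * weyl v * Wᴴ).IsDiag) :
    diagIndOp V u = diagIndOp W v := by
  unfold diagIndOp
  exact if_congr h rfl rfl

theorem diagonal_diag_conj_weyl {n : ℕ} (V : cliffordUnitaries n) (v : Phase n) :
    diagonal (V.1.1 * weyl v * V.1.1ᴴ).diag
      = (diagIndOp V.1.1 v : ℂ) • (V.1.1 * weyl v * V.1.1ᴴ) := by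
  by_cases h : (V.1.1 * weyl v * V.1.1ᴴ).IsDiag
  · rw [diagIndOp, if_pos h, h.diagonal_diag]
    simp
  · obtain ⟨k, u, hu⟩ := conj_weyl_eq V v
    rw [diagIndOp, if_neg h, hu]
    rw [hu] at h
    have h0 := (weyl_isDiag_or_diag_eq_zero u).resolve_left fun h' => h (h'.smul _)
    rw [Matrix.diag_smul, h0]
    simp

theorem diagIndOp_mul_self {n : ℕ} (V : Op n) (v : Phase n) :
    diagIndOp V v * diagIndOp V v = diagIndOp V v := by
  rw [diagIndOp]; split_ifs <;> simp

theorem conjTranspose_mul_self_of_mem {n : ℕ} (V : U n) : V.1ᴴ * V.1 = 1 :=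
  Matrix.mem_unitaryGroup_iff'.mp V.2

theorem mul_conjTranspose_self_of_mem {n : ℕ} (V : U n) : V.1 * V.1ᴴ = 1 :=
  Matrix.mem_unitaryGroup_iff.mp V.2

theorem conj_mul_conj {n : ℕ} (V : U n) (A B : Op n) :
    (V.1 * A * V.1ᴴ) * (V.1 * B * V.1ᴴ) = V.1 * (A * B) * V.1ᴴ := by
  calc _ = V.1 * A * (V.1ᴴ * V.1) * B * V.1ᴴ := by simp only [mul_assoc]
    _ = _ := by rw [conjTranspose_mul_self_of_mem, mul_one]; simp only [mul_assoc]

theorem trace_conj {n : ℕ} (V : U n) (A : Op n) : (V.1 * A * V.1ᴴ).trace = A.trace := by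
  rw [Matrix.trace_mul_comm, ← mul_assoc, conjTranspose_mul_self_of_mem, one_mul]

theorem diagIndOp_zero {n : ℕ} (V : U n) : diagIndOp V.1 0 = 1 := by
  rw [diagIndOp, if_pos]
  rw [weyl_zero, mul_one, mul_conjTranspose_self_of_mem]
  exact Matrix.isDiag_one

/-- If two conjugated Pauli strings are both diagonal, then they commute. -/
theorem diagIndOp_mul_eq_zero {n : ℕ} (V : U n) {u v : Phase n} (h : symp u v ≠ 0) :
    diagIndOp V.1 u * diagIndOp V.1 v = 0 := by
  by_contra hne
  have hu : (V.1 * weyl u * V.1ᴴ).IsDiag := by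
    by_contra h'
    exact hne (by rw [diagIndOp, if_neg h', zero_mul])
  have hv : (V.1 * weyl v * V.1ᴴ).IsDiag := by
    by_contra h'
    exact hne (by rw [mul_comm, diagIndOp, if_neg h', zero_mul])
  have e : (V.1 * weyl u * V.1ᴴ) * (V.1 * weyl v * V.1ᴴ)
      = (V.1 * weyl v * V.1ᴴ) * (V.1 * weyl u * V.1ᴴ) := by
    rw [← hu.diagonal_diag, ← hv.diagonal_diag, Matrix.diagonal_mul_diagonal,
      Matrix.diagonal_mul_diagonal]
    simp only [mul_comm]
  rw [conj_mul_conj, conj_mul_conj, weyl_comm u v, show parity (symp u v) = -1 from if_neg h,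
    neg_one_smul, mul_neg, neg_mul, neg_eq_iff_add_eq_zero, ← two_smul ℂ,
    smul_eq_zero_iff_right two_ne_zero] at e
  -- Anticommutation has made a product of unitaries zero; multiplying by its inverse gives `0 = 1`.
  have e2 := congrArg (fun M => M * (V.1 * (weyl u * weyl v) * V.1ᴴ)) e
  simp only [zero_mul, conj_mul_conj] at e2
  rw [show weyl v * weyl u * (weyl u * weyl v) = 1 by
    rw [mul_assoc, ← mul_assoc (weyl u), weyl_mul_self, one_mul, weyl_mul_self], mul_one,
    mul_conjTranspose_self_of_mem] at e2
  exact one_ne_zero e2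

/-- Each Clifford unitary maps exactly `2^n` Pauli strings to diagonal ones. -/
theorem sum_diagIndOp {n : ℕ} (V : cliffordUnitaries n) :
    ∑ v, diagIndOp V.1.1 v = 2 ^ n := by
  -- Any basis vector would do: the `(b, b)` entry of the Pauli expansion of `V† |b⟩⟨b| V`,
  -- conjugated back by `V`, gives `∑ v, (V W_v V†)_{bb} ^ 2 = 2 ^ n`.
  let b : Bits n := fun _ => 0
  let D : Op n := V.1.1ᴴ * Matrix.single b b 1 * V.1.1
  have htr : ∀ v, (weyl v * D).trace = (V.1.1 * weyl v * V.1.1ᴴ) b b := fun v => by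
    rw [show weyl v * D = (weyl v * V.1.1ᴴ * Matrix.single b b 1) * V.1.1 by
      simp only [D, mul_assoc], Matrix.trace_mul_comm, ← mul_assoc, ← mul_assoc,
      Matrix.trace_mul_single]
    simp
  -- The conjugated string squares to `1`, so the squared entry is `1` when it is diagonal, and `0`
  -- otherwise.
  have hsq : ∀ v, (V.1.1 * weyl v * V.1.1ᴴ) b b * (V.1.1 * weyl v * V.1.1ᴴ) b b
      = (diagIndOp V.1.1 v : ℂ) := fun v => by
    have h := congrFun (congrFun (congrArg₂ (fun M N : Op n => M * N) (diagonal_diag_conj_weyl V v)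
      (diagonal_diag_conj_weyl V v)) b) b
    simp only [Matrix.diagonal_mul_diagonal, smul_mul_smul_comm] at h
    rw [conj_mul_conj, weyl_mul_self, mul_one, mul_conjTranspose_self_of_mem,
      ← Complex.ofReal_mul, diagIndOp_mul_self] at h
    simpa using h
  have h := congrFun (congrFun (congrArg (fun M : Op n => V.1.1 * M * V.1.1ᴴ)
    (sum_trace_weyl_smul D)) b) b
  have hD : V.1.1 * D * V.1.1ᴴ = Matrix.single b b 1 := by
    calc _ = (V.1.1 * V.1.1ᴴ) * Matrix.single b b 1 * (V.1.1 * V.1.1ᴴ) := by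
          simp only [D, mul_assoc]
      _ = _ := by rw [mul_conjTranspose_self_of_mem, one_mul, mul_one]
  simp only [Finset.mul_sum, Finset.sum_mul, mul_smul_comm, smul_mul_assoc, hD, htr,
    Matrix.sum_apply, Matrix.smul_apply, smul_eq_mul, hsq, Matrix.single_apply_same,
    mul_one] at h
  exact_mod_cast h

/-- Expand `A` in Pauli strings; passing to the diagonal keeps exactly the terms whose conjugates
are diagonal. -/
theorem diagonal_diag_conj {n : ℕ} (V : cliffordUnitaries n) (A : Op n) :
    (2 : ℂ) ^ n • diagonal (V.1.1 * A * V.1.1ᴴ).diag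
      = ∑ v, ((diagIndOp V.1.1 v : ℂ) * (weyl v * A).trace) • (V.1.1 * weyl v * V.1.1ᴴ) := by
  rw [← Matrix.diagonal_smul, ← Matrix.diag_smul, ← smul_mul_assoc, ← mul_smul_comm,
    ← sum_trace_weyl_smul, Finset.mul_sum, Finset.sum_mul, Matrix.diag_sum]
  rw [show ∀ f : Phase n → Bits n → ℂ, diagonal (∑ v, f v) = ∑ v, diagonal (f v) from
    fun f => map_sum (Matrix.diagonalAddMonoidHom (Bits n) ℂ) f Finset.univ]
  refine Finset.sum_congr rfl fun v _ => ?_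
  rw [mul_smul_comm, smul_mul_assoc, Matrix.diag_smul, Matrix.diagonal_smul,
    diagonal_diag_conj_weyl, smul_smul, mul_comm]

/-- The pair correlation of the measured diagonals, in terms of Pauli coefficients. -/
theorem sum_diag_mul_diag {n : ℕ} (V : cliffordUnitaries n) (A B : Op n) :
    (2 : ℂ) ^ n * ∑ b, (V.1.1 * A * V.1.1ᴴ) b b * (V.1.1 * B * V.1.1ᴴ) b b
      = ∑ v, (diagIndOp V.1.1 v : ℂ) * ((weyl v * A).trace * (weyl v * B).trace) := by
  have h := congrArg (fun M => (M * (V.1.1 * B * V.1.1ᴴ)).trace) (diagonal_diag_conj V A)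
  simp only [smul_mul_assoc, Matrix.trace_smul, Finset.sum_mul, Matrix.trace_sum, conj_mul_conj,
    trace_conj, smul_eq_mul] at h
  simp only [← mul_assoc]
  rw [← h]
  simp [Matrix.trace, Matrix.diagonal_mul]

/-- The triple correlation of the measured diagonals, in terms of Pauli coefficients. -/
theorem sum_diag_mul_diag_mul_diag {n : ℕ} (V : cliffordUnitaries n) (A B D : Op n) :
    ((2 : ℂ) ^ n) ^ 2 * ∑ b, (V.1.1 * A * V.1.1ᴴ) b b * (V.1.1 * B * V.1.1ᴴ) b b
        * (V.1.1 * D * V.1.1ᴴ) b b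
      = ∑ u, ∑ v, ((diagIndOp V.1.1 u * diagIndOp V.1.1 v : ℝ) : ℂ)
        * ((weyl u * A).trace * (weyl v * B).trace * (weyl u * weyl v * D).trace) := by
  have h := congrArg₂ (fun M N => (M * N * (V.1.1 * D * V.1.1ᴴ)).trace)
    (diagonal_diag_conj V A) (diagonal_diag_conj V B)
  simp only [smul_mul_smul_comm, Finset.sum_mul_sum] at h
  simp only [smul_mul_assoc, Matrix.trace_smul, Finset.sum_mul, Matrix.trace_sum, conj_mul_conj, trace_conj, smul_eq_mul] at h
  refine Eq.trans ?_ (h.trans ?_)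
  · rw [sq, Matrix.diagonal_mul_diagonal]
    simp [Matrix.trace, Matrix.diagonal_mul]
  · refine Finset.sum_congr rfl fun u _ => Finset.sum_congr rfl fun v _ => ?_
    push_cast
    ring

/-! ### Averages over the Clifford group -/

/-- Makes the quotient a group, so that right translation permutes the Clifford group and sums over
it can be reindexed. -/
instance (n : ℕ) : (globalPhases n).Normal where
  conj_mem := by
    rintro V ⟨z, hz, hV⟩ W
    refine ⟨z, hz, ?_⟩
    change W.1.1 * V.1.1 * W.1.1ᴴ = _
    rw [hV, mul_smul_comm, mul_one, smul_mul_assoc, mul_conjTranspose_self_of_mem]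

/-- Right multiplication by a Clifford unitary, as a permutation of the Clifford group. -/
noncomputable def Clifford.mulRight {n : ℕ} (W : cliffordUnitaries n) : Clifford n ≃ Clifford n :=
  Equiv.mulRight (G := cliffordUnitaries n ⧸ globalPhases n) (QuotientGroup.mk W)

/-- `1` if `C W_v C†` is diagonal, and `0` otherwise. -/
noncomputable def Clifford.diagInd {n : ℕ} (C : Clifford n) (v : Phase n) : ℝ :=
  Quotient.lift (fun V : cliffordUnitaries n => diagIndOp V.1.1 v) (fun V W h => by
    obtain ⟨z, hz, e⟩ := exists_phase h
    have hzz : z * star z = 1 := by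
      rw [Complex.star_def, Complex.mul_conj, Complex.normSq_eq_norm_sq, hz]; simp
    have h' : W.1.1 * weyl v * W.1.1ᴴ = V.1.1 * weyl v * V.1.1ᴴ := by
      simp only [e, Matrix.conjTranspose_smul, Matrix.smul_mul, Matrix.mul_smul, smul_smul, hzz,
        mul_comm (star z) z, one_smul]
    exact diagIndOp_congr (by rw [h'])) C

theorem isDiag_smul_iff {n : ℕ} {c : ℂ} (hc : c ≠ 0) (A : Op n) :
    (c • A).IsDiag ↔ A.IsDiag := by
  refine ⟨fun h => ?_, fun h => h.smul c⟩
  have := h.smul c⁻¹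
  rwa [smul_smul, inv_mul_cancel₀ hc, one_smul] at this

/-- The phase produced by conjugating `W_v` is nonzero and does not affect diagonality, so only the
label moves. -/
theorem Clifford.diagInd_mulRight {n : ℕ} (C : Clifford n) (w v : Phase n) :
    (Clifford.mulRight ⟨_, cliffordTransvection_mem_cliffordUnitaries w⟩ C).diagInd v
      = C.diagInd (transvection w v) := by
  induction C using Quotient.inductionOn with
  | h V =>
    change diagIndOp (V.1.1 * cliffordTransvection w) v = diagIndOp V.1.1 (transvection w v)
    obtain ⟨k, hk⟩ := cliffordTransvection_conj_weyl w v
    have e : V.1.1 * cliffordTransvection w * weyl v * (V.1.1 * cliffordTransvection w)ᴴ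
        = Complex.I ^ k • (V.1.1 * weyl (transvection w v) * V.1.1ᴴ) := by
      rw [← smul_mul_assoc, ← mul_smul_comm, ← hk, Matrix.conjTranspose_mul]
      simp only [mul_assoc]
    exact diagIndOp_congr (by rw [e, isDiag_smul_iff (pow_ne_zero k Complex.I_ne_zero)])

/-- The sum over the Clifford group of the indicator that `C W_u C†` and `C W_v C†` are both
diagonal. -/
noncomputable def pairSum {n : ℕ} (u v : Phase n) : ℝ :=
  ∑ C : Clifford n, C.diagInd u * C.diagInd v

theorem pairSum_comm {n : ℕ} (u v : Phase n) : pairSum u v = pairSum v u := by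
  simp only [pairSum, mul_comm]

theorem pairSum_transvection {n : ℕ} (w u v : Phase n) :
    pairSum (transvection w u) (transvection w v) = pairSum u v := by
  simp only [pairSum, ← Clifford.diagInd_mulRight]
  exact Equiv.sum_comp (Clifford.mulRight _) fun C : Clifford n => C.diagInd u * C.diagInd v

theorem Clifford.diagInd_zero {n : ℕ} (C : Clifford n) : C.diagInd 0 = 1 := by
  induction C using Quotient.inductionOn with
  | h V => exact diagIndOp_zero V.1

theorem Clifford.diagInd_mul_self {n : ℕ} (C : Clifford n) (v : Phase n) :
    C.diagInd v * C.diagInd v = C.diagInd v := by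
  induction C using Quotient.inductionOn with
  | h V => exact diagIndOp_mul_self V.1.1 v

theorem Clifford.sum_diagInd {n : ℕ} (C : Clifford n) : ∑ v, C.diagInd v = 2 ^ n := by
  induction C using Quotient.inductionOn with
  | h V => exact sum_diagIndOp V

theorem pairSum_eq_zero {n : ℕ} {u v : Phase n} (h : symp u v ≠ 0) : pairSum u v = 0 :=
  Finset.sum_eq_zero fun C _ => by
    induction C using Quotient.inductionOn with
    | h V => exact diagIndOp_mul_eq_zero V.1 h

theorem pairSum_self {n : ℕ} (u : Phase n) : pairSum u u = pairSum u 0 := by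
  simp only [pairSum, Clifford.diagInd_mul_self, Clifford.diagInd_zero, mul_one]

theorem pairSum_zero_zero (n : ℕ) : pairSum (0 : Phase n) 0 = Fintype.card (Clifford n) := by
  simp [pairSum, Clifford.diagInd_zero]

/-- Double counting: for each Clifford that makes `W_u` diagonal, exactly `2 ^ n` choices of `v`
contribute. -/
theorem sum_pairSum {n : ℕ} (u : Phase n) : ∑ v, pairSum u v = 2 ^ n * pairSum u 0 := by
  simp only [pairSum, Clifford.diagInd_zero, mul_one]
  rw [Finset.sum_comm, Finset.mul_sum]
  simp only [← Finset.mul_sum, Clifford.sum_diagInd, mul_comm]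

/-- Transvections act transitively on nonzero vectors, so `pairSum · 0` is constant there. -/
theorem pairSum_zero_right_eq {n : ℕ} {u u' : Phase n} (hu : u ≠ 0) (hu' : u' ≠ 0) :
    pairSum u 0 = pairSum u' 0 := by
  have step : ∀ {x y : Phase n}, symp x y = 1 → pairSum x 0 = pairSum y 0 := fun {x y} h => by
    rw [← pairSum_transvection (x + y) x 0, transvection_add_self h, transvection_zero]
  -- Two moves `u → w → u'`; taking `0` as the vector to be fixed makes the orthogonality condition
  -- void.
  obtain ⟨w, -, h, h'⟩ := exists_symp_zero_one_one (u := 0) hu hu hu' hu'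
  rw [step h, step (symp_comm u' w ▸ h')]

/-- The transvections fixing `u` act transitively on the vectors orthogonal to `u` outside the
span of `u`. -/
theorem pairSum_right_eq {n : ℕ} {u v v' : Phase n} (hv : v ≠ 0) (huv : v ≠ u) (hv' : v' ≠ 0)
    (huv' : v' ≠ u) (h : symp u v = 0) (h' : symp u v' = 0) : pairSum u v = pairSum u v' := by
  have step : ∀ {x y : Phase n}, symp u x = 0 → symp u y = 0 → symp x y = 1 →
      pairSum u x = pairSum u y := fun {x y} hx hy h => by
    rw [← pairSum_transvection (x + y) u x, transvection_add_self h,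
      transvection_of_symp_eq_zero]
    rw [symp_comm, symp_add_right, hx, hy, add_zero]
  obtain ⟨w, h0, h1, h2⟩ := exists_symp_zero_one_one hv huv hv' huv'
  rw [step h h0 h1, step h0 h' (symp_comm v' w ▸ h2)]

theorem sum_pairSum_zero_right (n : ℕ) :
    ∑ v : Phase n, pairSum v 0 = 2 ^ n * Fintype.card (Clifford n) := by
  rw [← pairSum_zero_zero, ← sum_pairSum]
  exact Finset.sum_congr rfl fun v _ => pairSum_comm _ _

theorem two_le_two_pow_of_ne_zero {n : ℕ} {u : Phase n} (hu : u ≠ 0) : (2 : ℝ) ≤ 2 ^ n := by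
  obtain ⟨j, -⟩ := Function.ne_iff.mp hu
  exact le_self_pow₀ one_le_two (Fin.pos j).ne'

theorem pairSum_zero_right {n : ℕ} {u : Phase n} (hu : u ≠ 0) :
    pairSum u 0 = Fintype.card (Clifford n) * (1 / (2 ^ n + 1)) := by
  have h := sum_pairSum_zero_right n
  rw [← Finset.add_sum_erase _ _ (Finset.mem_univ 0), Finset.sum_congr rfl fun v hv =>
    pairSum_zero_right_eq (Finset.ne_of_mem_erase hv) hu, Finset.sum_const, nsmul_eq_mul,
    Finset.card_erase_of_mem (Finset.mem_univ _), Finset.card_univ,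
    Nat.cast_sub Fintype.card_pos, card_phase, pairSum_zero_zero] at h
  have hd := two_le_two_pow_of_ne_zero hu
  set d : ℝ := 2 ^ n
  -- The zero label contributes `N = Fintype.card (Clifford n)` to the total `d N`, and the other
  -- `d² - 1` labels share the rest equally. A nonzero label forces `d ≥ 2`, so `d - 1` cancels.
  have h1 : (d - 1) * ((d + 1) * pairSum u 0 - Fintype.card (Clifford n)) = 0 := by
    push_cast at h
    linear_combination h
  rcases mul_eq_zero.mp h1 with h2 | h2
  · linarith
  · field_simp
    linarith

theorem pairSum_of_independent {n : ℕ} {u v : Phase n} (hu : u ≠ 0) (hv : v ≠ 0) (hvu : v ≠ u)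
    (h : symp u v = 0) :
    pairSum u v = Fintype.card (Clifford n) * (2 / ((2 ^ n + 1) * (2 ^ n + 2))) := by
  let K : Finset (Phase n) := Finset.univ.filter fun w => symp u w = 0
  have h0K : (0 : Phase n) ∈ K := by simp [K, symp_zero_right]
  have huK : u ∈ K.erase 0 := by simp [K, symp_self, hu]
  have hvK : v ∈ (K.erase 0).erase u := by simp [K, hv, hvu, h]
  have hconst : ∀ w ∈ (K.erase 0).erase u, pairSum u w = pairSum u v := fun w hw => by
    simp only [K, Finset.mem_erase, Finset.mem_filter, Finset.mem_univ, true_and] at hw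
    exact pairSum_right_eq hw.2.1 hw.1 hv hvu hw.2.2 h
  have hsum := sum_pairSum u
  rw [← Finset.sum_subset (Finset.subset_univ K) (fun w _ hw => pairSum_eq_zero fun h' =>
      hw (by simp [K, h'])), ← Finset.add_sum_erase _ _ h0K, ← Finset.add_sum_erase _ _ huK,
    Finset.sum_congr rfl hconst, Finset.sum_const, nsmul_eq_mul, pairSum_self] at hsum
  have hcard : (((K.erase 0).erase u).card : ℝ) + 2 = K.card := by
    rw [← Finset.card_erase_add_one h0K, ← Finset.card_erase_add_one huK]
    push_cast
    ring
  have hK : (2 : ℝ) * K.card = (2 ^ n) ^ 2 := card_symp_eq_zero hu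
  -- The label `v` itself shows that `d² / 2 - 2` is positive, which excludes `d = 2` when `d - 2`
  -- is cancelled below.
  have hpos : (1 : ℝ) ≤ ((K.erase 0).erase u).card := by
    exact_mod_cast Finset.card_pos.mpr ⟨v, hvK⟩
  have hd := two_le_two_pow_of_ne_zero hu
  have ha := pairSum_zero_right hu
  generalize (((K.erase 0).erase u).card : ℝ) = m at hsum hcard hpos
  generalize (2 : ℝ) ^ n = d at *
  generalize (Fintype.card (Clifford n) : ℝ) = N at *
  generalize pairSum u 0 = a at *
  generalize pairSum u v = c at *
  have hm : m = d ^ 2 / 2 - 2 := by linarith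
  subst hm
  -- Of the total `d a` over the complement of `u`, the labels `0` and `u` take `a` each; the other
  -- `d² / 2 - 2` labels take `c` each.
  have h1 : (d - 2) * ((d + 2) * c - 2 * a) = 0 := by linear_combination 2 * hsum
  rcases mul_eq_zero.mp h1 with h2 | h2
  · nlinarith
  · subst ha
    have hc : c = 2 * (N * (1 / (d + 1))) / (d + 2) := by
      field_simp
      field_simp at h2
      linarith
    rw [hc]
    field_simp

/-- The average over the Clifford group of the pair indicator. -/
noncomputable def pairWeight (n : ℕ) (u v : Phase n) : ℝ :=
  ((if symp u v = 0 then 1 else 0) * 2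
    + ((if u = 0 then 1 else 0) + (if v = 0 then 1 else 0) + (if u = v then 1 else 0)) * 2 ^ n
    + (if u = 0 then 1 else 0) * (if v = 0 then 1 else 0) * (2 ^ n) ^ 2)
    / ((2 ^ n + 1) * (2 ^ n + 2))

/-- Merges the orbit values into one combination of indicators, so that each indicator can be
resummed separately. -/
theorem pairSum_eq {n : ℕ} (u v : Phase n) :
    pairSum u v = Fintype.card (Clifford n) * pairWeight n u v := by
  have hd : (0 : ℝ) < 2 ^ n := by positivity
  rw [pairWeight]
  by_cases hu : u = 0
  · subst hu
    by_cases hv : v = 0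
    · subst hv
      rw [pairSum_zero_zero]
      simp only [symp_self, if_true]
      field_simp
      ring
    · rw [pairSum_comm, pairSum_zero_right hv]
      simp only [symp_zero_left, hv, Ne.symm hv, if_true, if_false]
      field_simp
      ring
  · by_cases hv : v = 0
    · subst hv
      rw [pairSum_zero_right hu]
      simp only [symp_zero_right, hu, if_true, if_false]
      field_simp
      ring
    · by_cases huv : u = v
      · subst huv
        rw [pairSum_self, pairSum_zero_right hu]
        simp only [symp_self, hu, if_true, if_false]
        field_simp
        ring
      · by_cases h : symp u v = 0
        · rw [pairSum_of_independent hu hv (Ne.symm huv) h]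
          simp only [h, hu, hv, huv, if_true, if_false]
          field_simp
          ring
        · rw [pairSum_eq_zero h]
          simp [h, hu, hv, huv]

/-! ### Fidelity with a pure state -/

theorem expVal_eq_trace {n : ℕ} (ρ : Density n) (ψ : EuclideanSpace ℂ (Bits n)) :
    expVal ρ ψ = (vecMulVec ψ.ofLp (star ψ.ofLp) * ρ.1).trace := by
  rw [Matrix.vecMulVec_mul, Matrix.trace_vecMulVec, expVal, Matrix.dotProduct_mulVec,
    dotProduct_comm]

theorem star_dotProduct_self_eq_norm_sq {n : ℕ} (w : Bits n → ℂ) :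
    star w ⬝ᵥ w = ((‖WithLp.toLp 2 w‖ ^ 2 : ℝ) : ℂ) := by
  have h := EuclideanSpace.inner_eq_star_dotProduct (WithLp.toLp 2 w) (WithLp.toLp 2 w)
  rw [inner_self_eq_norm_sq_to_K] at h
  rw [dotProduct_comm]
  exact h.symm.trans (by push_cast; rfl)

/-- The square of `w w†` is `‖w‖² w w†`. For `w = 0` both sides vanish, with `‖w‖⁻¹ = 0` by
convention. -/
theorem sqrt_vecMulVec_self_star {n : ℕ} (w : Bits n → ℂ) :
    CFC.sqrt (vecMulVec w (star w))
      = ((‖WithLp.toLp 2 w‖⁻¹ : ℝ) : ℂ) • vecMulVec w (star w) := by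
  refine CFC.sqrt_unique ?_ ?_
  · rw [smul_mul_smul_comm, Matrix.vecMulVec_mul_vecMulVec, star_dotProduct_self_eq_norm_sq]
    by_cases h : ‖WithLp.toLp 2 w‖ = 0
    · have hw : w = 0 := by simpa using h
      simp [hw]
    · rw [Matrix.vecMulVec_smul, smul_smul, ← Complex.ofReal_mul, ← Complex.ofReal_mul]
      rw [show ‖WithLp.toLp 2 w‖⁻¹ * ‖WithLp.toLp 2 w‖⁻¹ * ‖WithLp.toLp 2 w‖ ^ 2 = 1 by
        field_simp]
      simp
  · refine Matrix.nonneg_iff_posSemidef.mpr ?_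
    refine (Matrix.posSemidef_vecMulVec_self_star w).smul ?_
    rw [Complex.zero_le_real]
    positivity

/-- With `R = √ρ`, the operator `R |ψ⟩⟨ψ| R` has rank at most one, built from `Rψ`. The trace of its
root is `‖Rψ‖`, whose square is `⟨ψ|ρ|ψ⟩`. -/
theorem fidelity_pureState {n : ℕ} (ρ : Density n) (ψ : EuclideanSpace ℂ (Bits n))
    (hψ : ‖ψ‖ = 1) : (fidelity ρ (pureState ψ hψ) : ℂ) = expVal ρ ψ := by
  have hρ : (0 : Op n) ≤ ρ.1 := Matrix.nonneg_iff_posSemidef.mpr ρ.2.1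
  set R : Op n := CFC.sqrt ρ.1 with hR
  have hRR : R * R = ρ.1 := CFC.sqrt_mul_sqrt_self ρ.1 hρ
  have hRh : Rᴴ = R := (Matrix.nonneg_iff_posSemidef.mp (CFC.sqrt_nonneg ρ.1)).1
  have h1 : R * (pureState ψ hψ).1 * R = vecMulVec (R *ᵥ ψ.ofLp) (star (R *ᵥ ψ.ofLp)) := by
    rw [pureState, Matrix.mul_vecMulVec, Matrix.vecMulVec_mul, Matrix.star_mulVec, hRh]
  have h2 : expVal ρ ψ = ((‖WithLp.toLp 2 (R *ᵥ ψ.ofLp)‖ ^ 2 : ℝ) : ℂ) := by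
    rw [← star_dotProduct_self_eq_norm_sq, Matrix.star_mulVec, hRh, ← Matrix.dotProduct_mulVec,
      Matrix.mulVec_mulVec, hRR, expVal]
  rw [h2, fidelity, ← hR, h1, sqrt_vecMulVec_self_star, Matrix.trace_smul,
    Matrix.trace_vecMulVec, dotProduct_comm, star_dotProduct_self_eq_norm_sq, smul_eq_mul,
    ← Complex.ofReal_mul, Complex.ofReal_re]
  congr 2
  by_cases h : ‖WithLp.toLp 2 (R *ᵥ ψ.ofLp)‖ = 0
  · simp [h]
  · field_simp

/-! ### Moments of the overlap -/

theorem Density.ofReal_re_diag {n : ℕ} (σ : Density n) (b : Bits n) :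
    ((σ.1 b b).re : ℂ) = σ.1 b b :=
  Complex.ext rfl (Complex.nonneg_iff.mp (σ.2.1.diag_nonneg (i := b))).2

theorem ofReal_overlapOp {n : ℕ} (V : U n) (ψ : EuclideanSpace ℂ (Bits n)) (hψ : ‖ψ‖ = 1)
    (b : Bits n) : (overlapOp V ψ b : ℂ) = (V.1 * (pureState ψ hψ).1 * V.1ᴴ) b b := by
  rw [pureState, Matrix.mul_vecMulVec, Matrix.vecMulVec_mul, ← Matrix.star_mulVec, Matrix.vecMulVec_apply,
    overlapOp, Pi.star_apply, Complex.star_def, Complex.mul_conj, Complex.normSq_eq_norm_sq]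

theorem Clifford.sum_rotate_mul_overlap {n : ℕ} (C : Clifford n) (ρ : Density n)
    (ψ : EuclideanSpace ℂ (Bits n)) (hψ : ‖ψ‖ = 1) :
    (2 : ℂ) ^ n * ((∑ b, ((C.rotate ρ).1 b b).re * C.overlap ψ b : ℝ) : ℂ)
      = ∑ v, (C.diagInd v : ℂ) * ((weyl v * (pureState ψ hψ).1).trace
          * (weyl v * ρ.1).trace) := by
  induction C using Quotient.inductionOn with
  | h V =>
    refine Eq.trans ?_ (sum_diag_mul_diag V (pureState ψ hψ).1 ρ.1)
    rw [Complex.ofReal_sum]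
    refine congrArg _ (Finset.sum_congr rfl fun b _ => ?_)
    rw [Complex.ofReal_mul, Density.ofReal_re_diag, mul_comm, ← ofReal_overlapOp V.1 ψ hψ]
    rfl

theorem Clifford.sum_rotate_mul_overlap_sq {n : ℕ} (C : Clifford n) (ρ : Density n)
    (ψ : EuclideanSpace ℂ (Bits n)) (hψ : ‖ψ‖ = 1) :
    ((2 : ℂ) ^ n) ^ 2 * ((∑ b, ((C.rotate ρ).1 b b).re * C.overlap ψ b ^ 2 : ℝ) : ℂ)
      = ∑ u, ∑ v, ((C.diagInd u * C.diagInd v : ℝ) : ℂ)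
          * ((weyl u * (pureState ψ hψ).1).trace
            * (weyl v * (pureState ψ hψ).1).trace
            * (weyl u * weyl v * ρ.1).trace) := by
  induction C using Quotient.inductionOn with
  | h V =>
    refine Eq.trans ?_ (sum_diag_mul_diag_mul_diag V (pureState ψ hψ).1
      (pureState ψ hψ).1 ρ.1)
    rw [Complex.ofReal_sum]
    refine congrArg _ (Finset.sum_congr rfl fun b _ => ?_)
    rw [Complex.ofReal_mul, Density.ofReal_re_diag, mul_comm, ← ofReal_overlapOp V.1 ψ hψ,
      Complex.ofReal_pow, sq]
    rfl

theorem pairWeight_zero_right {n : ℕ} (v : Phase n) :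
    pairWeight n v 0 = (1 + (if v = 0 then 1 else 0) * 2 ^ n) / (2 ^ n + 1) := by
  have hd : (0 : ℝ) < 2 ^ n := by positivity
  rw [pairWeight, symp_zero_right]
  simp only [if_true]
  field_simp
  ring

theorem pureState_mul_self {n : ℕ} (ψ : EuclideanSpace ℂ (Bits n)) (hψ : ‖ψ‖ = 1) :
    (pureState ψ hψ).1 * (pureState ψ hψ).1 = (pureState ψ hψ).1 := by
  rw [pureState, Matrix.vecMulVec_mul_vecMulVec, star_dotProduct_self_eq_norm_sq]
  simp [hψ]

/-- The constant part of the weight resums to `d F` by completeness, and the zero label adds `d`;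
dividing by `d (d + 1)` gives the mean. -/
theorem sum_clifford_overlap {n : ℕ} (ρ : Density n) (ψ : EuclideanSpace ℂ (Bits n))
    (hψ : ‖ψ‖ = 1) :
    ∑ C : Clifford n, ∑ b, ((C.rotate ρ).1 b b).re * C.overlap ψ b
      = Fintype.card (Clifford n)
        * ((1 + fidelity ρ (pureState ψ hψ)) / ((2 : ℝ) ^ n + 1)) := by
  have hd : (2 : ℂ) ^ n ≠ 0 := by positivity
  have hd1 : (2 : ℂ) ^ n + 1 ≠ 0 := by exact_mod_cast (by positivity : (2 : ℝ) ^ n + 1 ≠ 0)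
  rw [← Complex.ofReal_inj]
  refine mul_left_cancel₀ hd ?_
  rw [Complex.ofReal_sum, Finset.mul_sum]
  simp only [Clifford.sum_rotate_mul_overlap _ ρ ψ hψ]
  have hp : ∀ v : Phase n, ∑ C : Clifford n, (C.diagInd v : ℂ)
      = Fintype.card (Clifford n) * (pairWeight n v 0 : ℂ) := fun v => by
    rw [← Complex.ofReal_natCast, ← Complex.ofReal_mul, ← pairSum_eq, pairSum]
    simp [Clifford.diagInd_zero]
  rw [Finset.sum_comm]
  simp only [← Finset.sum_mul, hp, pairWeight_zero_right]
  have hf : ∑ v, (weyl v * (pureState ψ hψ).1).trace * (weyl v * ρ.1).trace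
      = 2 ^ n * (fidelity ρ (pureState ψ hψ) : ℂ) := by
    rw [sum_trace_weyl_mul_trace_weyl, fidelity_pureState, expVal_eq_trace]
    rfl
  push_cast
  simp only [apply_ite Complex.ofReal, Complex.ofReal_one, Complex.ofReal_zero, mul_assoc,
    ← Finset.mul_sum]
  simp only [div_mul_eq_mul_div, ← Finset.sum_div, add_mul, one_mul, Finset.sum_add_distrib, hf,
    ite_mul, zero_mul, Finset.sum_ite_eq', Finset.mem_univ, if_true, weyl_zero,
    (pureState ψ hψ).2.2, ρ.2.2]
  field_simp
  ring

/-- The five indicators of `pairWeight` contribute `2F`, `F`, `F`, `1`, `1` in units of `d²`, for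
commuting pairs, `u = 0`, `v = 0`, `u = v` and `u = v = 0`. -/
theorem sum_clifford_overlap_sq {n : ℕ} (ρ : Density n) (ψ : EuclideanSpace ℂ (Bits n))
    (hψ : ‖ψ‖ = 1) :
    ∑ C : Clifford n, ∑ b, ((C.rotate ρ).1 b b).re * C.overlap ψ b ^ 2
      = Fintype.card (Clifford n)
        * ((2 + 4 * fidelity ρ (pureState ψ hψ)) / (((2 : ℝ) ^ n + 1) * (2 ^ n + 2))) := by
  have hd : (2 : ℂ) ^ n ≠ 0 := by positivity
  have hd1 : (2 : ℂ) ^ n + 1 ≠ 0 := by exact_mod_cast (by positivity : (2 : ℝ) ^ n + 1 ≠ 0)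
  have hd2 : (2 : ℂ) ^ n + 2 ≠ 0 := by exact_mod_cast (by positivity : (2 : ℝ) ^ n + 2 ≠ 0)
  rw [← Complex.ofReal_inj]
  refine mul_left_cancel₀ (pow_ne_zero 2 hd) ?_
  rw [Complex.ofReal_sum, Finset.mul_sum]
  simp only [Clifford.sum_rotate_mul_overlap_sq _ ρ ψ hψ]
  have hp : ∀ u v : Phase n, ∑ C : Clifford n, ((C.diagInd u * C.diagInd v : ℝ) : ℂ)
      = Fintype.card (Clifford n) * (pairWeight n u v : ℂ) := fun u v => by
    rw [← Complex.ofReal_natCast, ← Complex.ofReal_mul, ← pairSum_eq, pairSum,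
      Complex.ofReal_sum]
  rw [Finset.sum_comm]
  simp only [Finset.sum_comm (s := (Finset.univ : Finset (Clifford n))), ← Finset.sum_mul, hp]
  have hf : (((pureState ψ hψ).1 * ρ.1).trace : ℂ) = fidelity ρ (pureState ψ hψ) := by
    rw [fidelity_pureState, expVal_eq_trace]
    rfl
  set P : Op n := (pureState ψ hψ).1 with hP
  have hPP : P * P = P := pureState_mul_self ψ hψ
  have hP1 : P.trace = 1 := (pureState ψ hψ).2.2
  have hsum := sum_trace_weyl_smul P
  set t : Phase n → ℂ := fun v => (weyl v * P).trace with ht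
  have ht0 : t 0 = 1 := by simp [ht, weyl_zero, hP1]
  -- After symmetrization both orderings are unrestricted sums, and each factors as `(∑ t_v W_v)² =
  -- d² P² = d² P`.
  have h1 : ∑ u, ∑ v, (if symp u v = 0 then (1 : ℂ) else 0)
      * (t u * t v * (weyl u * weyl v * ρ.1).trace) = (2 ^ n) ^ 2 * (P * ρ.1).trace := by
    have e1 : ∀ u v, (if symp u v = 0 then (1 : ℂ) else 0)
        * (t u * t v * (weyl u * weyl v * ρ.1).trace)
        = (1 / 2) * ((t u • weyl u) * (t v • weyl v) * ρ.1).trace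
          + (1 / 2) * ((t v • weyl v) * (t u • weyl u) * ρ.1).trace := fun u v => by
      have h := congrArg (fun M => (M * ρ.1).trace) (ite_symp_smul_weyl_mul u v)
      simp only [smul_mul_assoc, Matrix.trace_smul, smul_eq_mul, add_mul, Matrix.trace_add] at h
      simp only [smul_mul_smul_comm]
      simp only [smul_mul_assoc, Matrix.trace_smul, smul_eq_mul]
      linear_combination (t u * t v) * h
    have e2 : ∑ u, ∑ v, ((t u • weyl u) * (t v • weyl v) * ρ.1).trace
        = (2 ^ n) ^ 2 * (P * ρ.1).trace := by
      simp only [← Matrix.trace_sum, ← Finset.sum_mul, ← Finset.mul_sum]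
      simp only [ht, hsum, smul_mul_smul_comm, hPP]
      rw [smul_mul_assoc, Matrix.trace_smul, smul_eq_mul, sq]
    have e3 : ∑ u, ∑ v, ((t v • weyl v) * (t u • weyl u) * ρ.1).trace
        = (2 ^ n) ^ 2 * (P * ρ.1).trace := by rw [Finset.sum_comm, e2]
    simp only [e1, Finset.sum_add_distrib, ← Finset.mul_sum, e2, e3]
    ring
  have h2 : ∑ v, t v * (weyl v * ρ.1).trace = 2 ^ n * (P * ρ.1).trace :=
    sum_trace_weyl_mul_trace_weyl P ρ.1
  have h3 : ∑ v, t v * t v = 2 ^ n := by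
    rw [ht, sum_trace_weyl_mul_trace_weyl, hPP, hP1, mul_one]
  have h4 : ∀ u v, (pairWeight n u v : ℂ) * (t u * t v * (weyl u * weyl v * ρ.1).trace)
      = (2 * ((if symp u v = 0 then (1 : ℂ) else 0)
            * (t u * t v * (weyl u * weyl v * ρ.1).trace))
          + 2 ^ n * (if u = 0 then t v * (weyl v * ρ.1).trace else 0)
          + 2 ^ n * (if v = 0 then t u * (weyl u * ρ.1).trace else 0)
          + 2 ^ n * (if u = v then t u * t u else 0)
          + (2 ^ n) ^ 2 * (if u = 0 then (if v = 0 then 1 else 0) else 0))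
        / ((2 ^ n + 1) * (2 ^ n + 2)) := fun u v => by
    have a1 : (if u = 0 then t v * (weyl v * ρ.1).trace else 0)
        = (if u = 0 then (1 : ℂ) else 0) * (t u * t v * (weyl u * weyl v * ρ.1).trace) := by
      split_ifs with h
      · rw [h, ht0, weyl_zero, one_mul, one_mul, one_mul]
      · rw [zero_mul]
    have a2 : (if v = 0 then t u * (weyl u * ρ.1).trace else 0)
        = (if v = 0 then (1 : ℂ) else 0) * (t u * t v * (weyl u * weyl v * ρ.1).trace) := by
      split_ifs with h
      · rw [h, ht0, weyl_zero, one_mul, mul_one, mul_one]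
      · rw [zero_mul]
    have a3 : (if u = v then t u * t u else 0)
        = (if u = v then (1 : ℂ) else 0) * (t u * t v * (weyl u * weyl v * ρ.1).trace) := by
      split_ifs with h
      · rw [← h, weyl_mul_self, one_mul, one_mul, ρ.2.2, mul_one]
      · rw [zero_mul]
    have a4 : (if u = 0 then (if v = 0 then (1 : ℂ) else 0) else 0)
        = (if u = 0 then (1 : ℂ) else 0) * (if v = 0 then (1 : ℂ) else 0)
          * (t u * t v * (weyl u * weyl v * ρ.1).trace) := by
      by_cases hu : u = 0
      · by_cases hv : v = 0
        · simp only [hu, hv, if_true, ht0, weyl_zero, one_mul, ρ.2.2]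
        · simp [hv]
      · simp [hu]
    rw [a1, a2, a3, a4, pairWeight]
    push_cast
    simp only [apply_ite Complex.ofReal, Complex.ofReal_one, Complex.ofReal_zero]
    ring
  have h5 : ∑ u, ∑ v, (pairWeight n u v : ℂ) * (t u * t v * (weyl u * weyl v * ρ.1).trace)
      = (2 ^ n) ^ 2 * ((2 + 4 * (P * ρ.1).trace) / ((2 ^ n + 1) * (2 ^ n + 2))) := by
    simp only [h4, ← Finset.sum_div, Finset.sum_add_distrib, ← Finset.mul_sum, h1]
    simp only [Finset.sum_ite_irrel, Finset.sum_const_zero, Finset.sum_ite_eq,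
      Finset.sum_ite_eq', Finset.mem_univ, if_true, h2, h3]
    ring
  simp only [mul_assoc (Fintype.card (Clifford n) : ℂ), ← Finset.mul_sum]
  rw [h5, hf]
  push_cast
  ring

/-! ### Expectations under the joint law -/

theorem toReal_shadowLaw {n : ℕ} (ρ : Density n) (C : Clifford n) (b : Bits n) :
    (shadowLaw ρ (C, b)).toReal
      = (Fintype.card (Clifford n) : ℝ)⁻¹ * ((C.rotate ρ).1 b b).re := by
  classical
  have h : shadowLaw ρ (C, b)
      = (Fintype.card (Clifford n) : ENNReal)⁻¹ * ENNReal.ofReal ((C.rotate ρ).1 b b).re := by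
    rw [shadowLaw, PMF.bind_apply, tsum_fintype, Finset.sum_eq_single C]
    · rw [PMF.uniformOfFintype_apply, PMF.map_apply, tsum_fintype, Finset.sum_eq_single b]
      · simp [outcomeLaw]
      · intro b' _ hb'
        simp [Ne.symm hb']
      · simp
    · intro C' _ hC'
      rw [PMF.map_apply]
      simp [Ne.symm hC']
    · simp
  rw [h, ENNReal.toReal_mul, ENNReal.toReal_ofReal, ENNReal.toReal_inv, ENNReal.toReal_natCast]
  exact (Complex.nonneg_iff.mp ((C.rotate ρ).2.1.diag_nonneg (i := b))).1

theorem integral_shadowLaw {n : ℕ} (ρ : Density n) (f : Clifford n × Bits n → ℝ) :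
    ∫ ω, f ω ∂(shadowLaw ρ).toMeasure
      = (Fintype.card (Clifford n) : ℝ)⁻¹
        * ∑ C : Clifford n, ∑ b, ((C.rotate ρ).1 b b).re * f (C, b) := by
  rw [PMF.integral_eq_sum, Fintype.sum_prod_type]
  simp only [toReal_shadowLaw, smul_eq_mul, mul_assoc, ← Finset.mul_sum]

end CliffordShadow

theorem mainTheorem3 (n : ℕ) (ρ : CliffordShadow.Density n)
    (ψ : EuclideanSpace ℂ (CliffordShadow.Bits n)) (hψ : ‖ψ‖ = 1) :
    (CliffordShadow.fidelity ρ (CliffordShadow.pureState ψ hψ) : ℂ)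
        = CliffordShadow.expVal ρ ψ ∧
    ∫ ω, ω.1.overlap ψ ω.2 ∂(CliffordShadow.shadowLaw ρ).toMeasure
        = (1 + CliffordShadow.fidelity ρ (CliffordShadow.pureState ψ hψ)) / ((2 : ℝ) ^ n + 1) ∧
    ProbabilityTheory.variance (fun ω => ω.1.overlap ψ ω.2)
        (CliffordShadow.shadowLaw ρ).toMeasure
      ≤ 3 / ((2 : ℝ) ^ n + 1) ^ 2 := by
  have hN : (Fintype.card (CliffordShadow.Clifford n) : ℝ) ≠ 0 :=
    Nat.cast_ne_zero.mpr Fintype.card_ne_zero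
  have h1 : ∫ ω, ω.1.overlap ψ ω.2 ∂(CliffordShadow.shadowLaw ρ).toMeasure
      = (1 + CliffordShadow.fidelity ρ (CliffordShadow.pureState ψ hψ)) / ((2 : ℝ) ^ n + 1) := by
    rw [CliffordShadow.integral_shadowLaw, CliffordShadow.sum_clifford_overlap ρ ψ hψ,
      inv_mul_cancel_left₀ hN]
  have h2 : ∫ ω, ω.1.overlap ψ ω.2 ^ 2 ∂(CliffordShadow.shadowLaw ρ).toMeasure
      = (2 + 4 * CliffordShadow.fidelity ρ (CliffordShadow.pureState ψ hψ))
        / (((2 : ℝ) ^ n + 1) * (2 ^ n + 2)) := by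
    rw [CliffordShadow.integral_shadowLaw, CliffordShadow.sum_clifford_overlap_sq ρ ψ hψ,
      inv_mul_cancel_left₀ hN]
  refine ⟨CliffordShadow.fidelity_pureState ρ ψ hψ, h1, ?_⟩
  rw [ProbabilityTheory.variance_eq_sub .of_discrete, h1]
  simp only [Pi.pow_apply]
  rw [h2]
  have hF : 0 ≤ CliffordShadow.fidelity ρ (CliffordShadow.pureState ψ hψ) := sq_nonneg _
  have hd : (0 : ℝ) < 2 ^ n := by positivity
  generalize CliffordShadow.fidelity ρ (CliffordShadow.pureState ψ hψ) = F at *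
  generalize (2 : ℝ) ^ n = d at *
  -- Weakening `d + 2` to `d + 1` gives a common denominator, and `2 + 4F - (1 + F)² = 2 - (1 - F)²`
  -- is at most `2`.
  have h3 : (2 + 4 * F) / ((d + 1) * (d + 2)) ≤ (2 + 4 * F) / (d + 1) ^ 2 := by
    rw [sq]
    gcongr
    norm_num
  calc (2 + 4 * F) / ((d + 1) * (d + 2)) - ((1 + F) / (d + 1)) ^ 2
      ≤ (2 + 4 * F) / (d + 1) ^ 2 - ((1 + F) / (d + 1)) ^ 2 := by gcongr
    _ = (2 - (1 - F) ^ 2) / (d + 1) ^ 2 := by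
      rw [div_pow, ← sub_div]
      ring
    _ ≤ 3 / (d + 1) ^ 2 := by
      gcongr
      nlinarith [sq_nonneg (1 - F)]
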